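/- For a graph $H$ and a set $\mathcal F$ of graphs, let $ex(n,H,\mathcal F)$ denote the maximum number of copies of $H$ (that is, of subgraphs isomorphic to $H$) in a simple graph on $n$ vertices that contains no member of $\mathcal F$ as a (not necessarily induced) subgraph. Let $C_i$ denote the cycle with $i$ vertices. **Theorem 2.5.** Let $k,l,m$ be fixed integers with $k>l\ge 2$ and $m\ge 2$ such that $2k\ne ml$. Then $$ex\bigl(n,\,C_{ml},\,\{C_3,C_4,\ldots,C_{2l-1}\}\cup\{C_{2k}\}\bigr)=\Theta(n^m)\qquad (n\to\infty),$$ where the implied constants may depend on $k$, $l$ and $m$. -/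

import Mathlib

open Filter Asymptotics

noncomputable section

namespace GenTuran

/-- A finite graph, given on the vertex set `Fin v` for some number `v` of vertices. -/
abbrev FinGraph : Type := (v : ℕ) × SimpleGraph (Fin v)

/-- The cycle `C_a` as a finite graph on `a` vertices (used for `a ≥ 3`). -/
def cycle (a : ℕ) : FinGraph := ⟨a, SimpleGraph.cycleGraph a⟩

/-- The set of cycles `{C_3, C_4, ..., C_a}`. -/
def cyclesUpTo (a : ℕ) : Set FinGraph := {F | ∃ i, 3 ≤ i ∧ i ≤ a ∧ F = cycle i}

/-- `G` is `𝓕`-free: no member of `𝓕` is contained in `G` as a (not necessarily induced)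
subgraph. -/
def FamilyFree {V : Type*} (𝓕 : Set FinGraph) (G : SimpleGraph V) : Prop :=
  ∀ F ∈ 𝓕, F.2.Free G

open scoped Classical in
/-- The generalized Turán number `ex(n, H, 𝓕)`: the maximum number of copies of `H` (subgraphs
isomorphic to `H`) in an `𝓕`-free graph on `n` vertices. -/
def ex (n : ℕ) (H : FinGraph) (𝓕 : Set FinGraph) : ℕ :=
  (Finset.univ.filter fun G : SimpleGraph (Fin n) => FamilyFree 𝓕 G).sup
    fun G => G.copyCount H.2

end GenTuran

end

/-! Upper bound. Let `G` have girth at least `2l` and no `2k`-cycle, and let `P(u,v)` be the number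
of paths of length `l` from `u` to `v`. Cutting an `ml`-cycle into `m` arcs of length `l` bounds the
number of such cycles by `tr(P^m)`, hence by `(∑ P(u,v)^2)^(m/2)` via Cauchy–Schwarz
(`card_cycleMaps_le_trace`, `trace_pow_sq_le`). It remains to show `∑ P^2 = O(n^2)`.

The sum `∑ P^2` counts pairs of `l`-paths with common ends. By the girth condition, two distinct
such paths are internally disjoint and form a `2l`-cycle. If every arc of every cycle in a family of
`2l`-cycles lay in more than `2k` members, rerouting along members would produce a `2k`-cycle
(`GirthGE.exists_thin_arc`). So cycles can be peeled off through thin arcs, and there are at most a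
constant times as many `2l`-cycles as `l`-paths. Thus `∑ P^2 ≤ K ∑ P`, while `(∑ P)^2 ≤ n^2 ∑ P^2`;
together these give `∑ P^2 ≤ (K n)^2`.

Lower bound. Place `m` branch vertices on a ring and join consecutive ones by about `n/(ml)`
disjoint paths of length `l`. Every cycle has length `2l` or `ml` (`length_eq_of_mem_cycleMaps`),
and choosing one path in each gap gives `⌊n/(ml)⌋^m` copies of `C_{ml}`. -/

namespace GenTuran

variable {V : Type*}

/-! ### Labelled cycles, paths and copies. -/

/-- The labelled cycles of length `N` in `G`. -/
def cycleMaps (G : SimpleGraph V) (N : ℕ) : Set (ZMod N → V) :=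
  {g | Function.Injective g ∧ ∀ x, G.Adj (g x) (g (x + 1))}

/-- The first `L + 1` values of `q` form a path in `G`. -/
def IsPathFun (G : SimpleGraph V) (L : ℕ) (q : ℕ → V) : Prop :=
  (∀ s < L, G.Adj (q s) (q (s + 1))) ∧ Set.InjOn q (Set.Iic L)

/-- Copies of a cycle graph are labelled cycles. -/
def cycleMapsOfCopy (G : SimpleGraph V) (n : ℕ)
    (c : SimpleGraph.Copy (SimpleGraph.cycleGraph (n + 2)) G) : cycleMaps G (n + 2) :=
  ⟨fun x => c (show Fin (n + 2) from x), c.injective, fun x => c.toHom.map_rel <| by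
    rw [SimpleGraph.cycleGraph_adj]
    right
    exact add_sub_cancel_left (G := Fin (n + 2)) _ _⟩

lemma cycleMapsOfCopy_injective (G : SimpleGraph V) (n : ℕ) :
    Function.Injective (cycleMapsOfCopy G n) := by
  intro c d h
  ext a
  exact congrFun (congrArg Subtype.val h) a

lemma exists_copy_of_mem_cycleMaps {G : SimpleGraph V} {N : ℕ} (hN : 2 ≤ N) {g : ZMod N → V}
    (hg : g ∈ cycleMaps G N) :
    ∃ c : (SimpleGraph.cycleGraph N).Copy G, Set.range c = Set.range g := by
  obtain ⟨n, rfl⟩ := Nat.exists_eq_add_of_le' hN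
  obtain ⟨hg, hadj⟩ := hg
  refine ⟨⟨⟨fun x => g (show ZMod (n + 2) from x), ?_⟩, hg⟩, rfl⟩
  intro a b hab
  rw [SimpleGraph.cycleGraph_adj] at hab
  rcases hab with h | h
  · have : a = b + 1 := by rw [← h]; abel
    rw [this]
    exact (hadj b).symm
  · have : b = a + 1 := by rw [← h]; abel
    rw [this]
    exact hadj a

lemma cycleGraph_isContained_iff_cycleMaps (G : SimpleGraph V) {N : ℕ} (hN : 2 ≤ N) :
    (SimpleGraph.cycleGraph N).IsContained G ↔ (cycleMaps G N).Nonempty := by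
  constructor
  · rintro ⟨c⟩
    obtain ⟨n, rfl⟩ := Nat.exists_eq_add_of_le' hN
    exact ⟨_, (cycleMapsOfCopy G n c).2⟩
  · rintro ⟨g, hg⟩
    obtain ⟨c, -⟩ := exists_copy_of_mem_cycleMaps hN hg
    exact ⟨c⟩

lemma labelledCopyCount_eq_card {W : Type*} [Fintype V] [Fintype W] (G : SimpleGraph V)
    (H : SimpleGraph W) : G.labelledCopyCount H = Nat.card (H.Copy G) := by
  classical
  unfold SimpleGraph.labelledCopyCount
  rw [← Nat.card_eq_fintype_card]

lemma labelledCopyCount_le_card_cycleMaps [Fintype V] (G : SimpleGraph V) {N : ℕ} (hN : 2 ≤ N) :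
    G.labelledCopyCount (SimpleGraph.cycleGraph N) ≤ Nat.card (cycleMaps G N) := by
  obtain ⟨n, rfl⟩ := Nat.exists_eq_add_of_le' hN
  have : Finite (ZMod (n + 2) → V) := Pi.finite
  rw [labelledCopyCount_eq_card]
  exact Nat.card_le_card_of_injective _ (cycleMapsOfCopy_injective G n)

lemma exists_walk_of_adj (G : SimpleGraph V) (L : ℕ) (q : ℕ → V)
    (h : ∀ s < L, G.Adj (q s) (q (s + 1))) :
    ∃ w : G.Walk (q 0) (q L), w.length = L ∧ w.support = (List.range (L + 1)).map q := by
  induction L with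
  | zero => exact ⟨.nil, rfl, by simp⟩
  | succ L ih =>
    obtain ⟨w, hw, hs⟩ := ih fun s hs => h s (by omega)
    refine ⟨w.concat (h L (by omega)), by simp [hw], ?_⟩
    rw [SimpleGraph.Walk.support_concat, hs, List.range_succ (n := L + 1)]
    simp

lemma IsPathFun.exists_walk {G : SimpleGraph V} {L : ℕ} {q : ℕ → V} (h : IsPathFun G L q) :
    ∃ w : G.Walk (q 0) (q L), w.IsPath ∧ w.length = L ∧
      w.support = (List.range (L + 1)).map q := by
  obtain ⟨w, hw, hs⟩ := exists_walk_of_adj G L q h.1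
  refine ⟨w, ?_, hw, hs⟩
  rw [SimpleGraph.Walk.isPath_def, hs]
  refine List.Nodup.map_on ?_ List.nodup_range
  intro a ha b hb hab
  rw [List.mem_range] at ha hb
  exact h.2 (by simp; omega) (by simp; omega) hab

/-! ### Paths and cycles in graphs of large girth. -/

/-- Two short paths with the same ends agree in a graph without short cycles. -/
lemma path_eq_of_no_short_cycle {G : SimpleGraph V} {g : ℕ}
    (hG : ∀ (v : V) (c : G.Walk v v), c.IsCycle → g ≤ c.length) {u v : V} {p q : G.Walk u v}
    (hp : p.IsPath) (hq : q.IsPath) (hlen : p.length + q.length < g) : p = q := by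
  classical
  set H : SimpleGraph V := SimpleGraph.fromEdgeSet {e | e ∈ p.edges ∨ e ∈ q.edges} with hH
  have hle : H ≤ G := by
    intro a b hab
    rw [hH, SimpleGraph.fromEdgeSet_adj] at hab
    rcases hab.1 with h | h
    · exact p.adj_of_mem_edges h
    · exact q.adj_of_mem_edges h
  -- A cycle in the union of the two paths would have at most `p.length + q.length < g` edges; in a
  -- forest, paths with given ends are unique.
  have hac : H.IsAcyclic := by
    intro a c hc
    have h1 := hG a (c.mapLe hle) ((SimpleGraph.Walk.isCycle_mapLe hle).2 hc)
    have h2 : c.edges.toFinset ⊆ p.edges.toFinset ∪ q.edges.toFinset := by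
      intro e he
      rw [List.mem_toFinset] at he
      have := c.edges_subset_edgeSet he
      rw [hH, SimpleGraph.edgeSet_fromEdgeSet] at this
      simpa using this.1
    have h3 := (Finset.card_le_card h2).trans (Finset.card_union_le _ _)
    rw [List.toFinset_card_of_nodup hc.1.1.1] at h3
    have h4 := List.toFinset_card_le p.edges
    have h5 := List.toFinset_card_le q.edges
    simp only [SimpleGraph.Walk.length_edges, SimpleGraph.Walk.length_mapLe] at *
    omega
  have hpe : ∀ e ∈ p.edges, e ∈ H.edgeSet := by
    intro e he
    rw [hH, SimpleGraph.edgeSet_fromEdgeSet]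
    exact ⟨Or.inl he, G.not_isDiag_of_mem_edgeSet (p.edges_subset_edgeSet he)⟩
  have hqe : ∀ e ∈ q.edges, e ∈ H.edgeSet := by
    intro e he
    rw [hH, SimpleGraph.edgeSet_fromEdgeSet]
    exact ⟨Or.inr he, G.not_isDiag_of_mem_edgeSet (q.edges_subset_edgeSet he)⟩
  have h2 : p.transfer H hpe = q.transfer H hqe := congrArg Subtype.val
    ((hac.subsingleton_path u v).elim ⟨_, hp.transfer hpe⟩ ⟨_, hq.transfer hqe⟩)
  have h3 := congrArg SimpleGraph.Walk.support h2
  rw [SimpleGraph.Walk.support_transfer, SimpleGraph.Walk.support_transfer] at h3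
  exact SimpleGraph.Walk.ext_support h3

/-- `G` has no cycle of length less than `g`. -/
def GirthGE (G : SimpleGraph V) (g : ℕ) : Prop := ∀ (v : V) (c : G.Walk v v), c.IsCycle → g ≤ c.length

lemma girthGE_of_free {G : SimpleGraph V} {g : ℕ}
    (h : ∀ i, 3 ≤ i → i < g → (SimpleGraph.cycleGraph i).Free G) : GirthGE G g := by
  intro v c hc
  by_contra! hlt
  exact h _ hc.three_le_length hlt
    ((SimpleGraph.cycleGraph_isContained_iff hc.three_le_length).2 ⟨v, c, hc, rfl⟩)

lemma GirthGE.pathFun_unique {G : SimpleGraph V} {g : ℕ} (hG : GirthGE G g) {a b : ℕ} {q r : ℕ → V}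
    (hq : IsPathFun G a q) (hr : IsPathFun G b r) (h0 : q 0 = r 0) (h1 : q a = r b)
    (hab : a + b < g) : a = b ∧ ∀ s ≤ a, q s = r s := by
  obtain ⟨w, hw, hwl, hws⟩ := hq.exists_walk
  obtain ⟨w', hw', hwl', hws'⟩ := hr.exists_walk
  have := path_eq_of_no_short_cycle hG (p := w) (q := w'.copy h0.symm h1.symm) hw
    (by simpa using hw') (by simp [hwl, hwl', hab])
  have hs := congrArg SimpleGraph.Walk.support this
  rw [SimpleGraph.Walk.support_copy, hws, hws'] at hs
  have hl := congrArg List.length hs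
  simp only [List.length_map, List.length_range] at hl
  obtain rfl : a = b := by omega
  refine ⟨rfl, fun s hsa => ?_⟩
  exact List.map_inj_left.1 hs s (List.mem_range.2 (by omega))

lemma IsPathFun.sub {G : SimpleGraph V} {L : ℕ} {q : ℕ → V} (h : IsPathFun G L q) {a b : ℕ}
    (hab : a + b ≤ L) : IsPathFun G b fun s => q (a + s) := by
  refine ⟨fun s hs => h.1 (a + s) (by omega), fun s hs t ht hst => ?_⟩
  simp only [Set.mem_Iic] at hs ht
  have := h.2 (by simp; omega : a + s ∈ Set.Iic L) (by simp; omega : a + t ∈ Set.Iic L) hst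
  omega

lemma IsPathFun.reverse {G : SimpleGraph V} {L : ℕ} {q : ℕ → V} (h : IsPathFun G L q) :
    IsPathFun G L fun s => q (L - s) := by
  refine ⟨fun s hs => ?_, fun s hs t ht hst => ?_⟩
  · have := h.1 (L - (s + 1)) (by omega)
    rw [show L - (s + 1) + 1 = L - s by omega] at this
    exact this.symm
  · simp only [Set.mem_Iic] at hs ht
    have := h.2 (by simp : L - s ∈ Set.Iic L) (by simp : L - t ∈ Set.Iic L) hst
    omega

/-- In a graph of girth at least `2 l`, two paths of length `l` with the same ends which share an
inner vertex are equal. -/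
lemma GirthGE.eq_of_inner_eq {G : SimpleGraph V} {l : ℕ} (hG : GirthGE G (2 * l)) {q r : ℕ → V}
    (hq : IsPathFun G l q) (hr : IsPathFun G l r) (h0 : q 0 = r 0) (h1 : q l = r l) {s t : ℕ}
    (hs0 : 0 < s) (hs : s < l) (ht0 : 0 < t) (ht : t < l) (hst : q s = r t) :
    ∀ x ≤ l, q x = r x := by
  -- Both paths are split at the common vertex. Since it is inner on each, the two initial pieces,
  -- and likewise the two final pieces, have total length below `2 * l`.
  have e1 := hG.pathFun_unique (hq.sub (a := 0) (b := s) (by omega))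
    (hr.sub (a := 0) (b := t) (by omega)) (by simpa using h0) (by simpa using hst) (by omega)
  have e2 := hG.pathFun_unique (hq.sub (a := s) (b := l - s) (by omega))
    (hr.sub (a := t) (b := l - t) (by omega)) (by simpa using hst)
    (by simp only [Nat.add_sub_cancel' hs.le, Nat.add_sub_cancel' ht.le, h1]) (by omega)
  obtain ⟨rfl, e1⟩ := e1
  intro x hx
  rcases le_total x s with h | h
  · simpa using e1 x h
  · have := e2.2 (x - s) (by omega)
    simpa only [Nat.add_sub_cancel' h] using this

/-- Two internally disjoint paths between two vertices form a cycle. -/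
lemma exists_cycleMap_of_paths {G : SimpleGraph V} {a b : ℕ} (ha : 0 < a) (hb : 0 < b)
    {q r : ℕ → V} (hq : IsPathFun G a q) (hr : IsPathFun G b r) (h1 : q a = r 0) (h2 : r b = q 0)
    (hd : ∀ s t, 0 < s → s < a → 0 < t → t < b → q s ≠ r t) :
    ∃ g ∈ cycleMaps G (a + b), (∀ s ≤ a, g (s : ZMod (a + b)) = q s) ∧
      ∀ s ≤ b, g ((a + s : ℕ) : ZMod (a + b)) = r s := by
  have : NeZero (a + b) := ⟨by omega⟩
  set F : ℕ → V := fun s => if s ≤ a then q s else r (s - a) with hF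
  have hFb : ∀ s, s ≤ b → F (a + s) = r s := by
    intro s hs
    rcases Nat.eq_zero_or_pos s with rfl | h
    · simp [hF, h1]
    · simp only [hF]
      rw [if_neg (by omega), Nat.add_sub_cancel_left]
  have hFa : ∀ s ≤ a, F s = q s := fun s hs => by simp [hF, hs]
  have hFN : F (a + b) = F 0 := by rw [hFb b le_rfl, hFa 0 (by omega), h2]
  have hval : ∀ s ≤ a + b, F ((s : ZMod (a + b)).val) = F s := by
    intro s hs
    rw [ZMod.val_natCast]
    rcases hs.lt_or_eq with h | rfl
    · rw [Nat.mod_eq_of_lt h]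
    · rw [Nat.mod_self, hFN]
  have hadj : ∀ s < a + b, G.Adj (F s) (F (s + 1)) := by
    intro s hs
    rcases lt_or_ge s a with h | h
    · rw [hFa s h.le, hFa (s + 1) h]
      exact hq.1 s h
    · obtain ⟨t, rfl⟩ := Nat.exists_eq_add_of_le h
      rw [hFb t (by omega), add_assoc, hFb (t + 1) (by omega)]
      exact hr.1 t (by omega)
  have hqr : ∀ s ≤ a, ∀ t, 0 < t → t < b → q s ≠ r t := by
    intro s hs t ht0 ht
    rcases Nat.eq_zero_or_pos s with rfl | h
    · intro h
      have := hr.2 (by simp; omega : t ∈ Set.Iic b) (by simp : b ∈ Set.Iic b) (by rw [← h, h2])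
      omega
    · rcases hs.lt_or_eq with h' | rfl
      · exact hd s t h h' ht0 ht
      · intro h
        have := hr.2 (by simp; omega : t ∈ Set.Iic b) (by simp : 0 ∈ Set.Iic b) (by rw [← h, h1])
        omega
  have hinj : ∀ s < a + b, ∀ t < a + b, F s = F t → s = t := by
    intro s hs t ht h
    rcases le_or_gt s a with hsa | hsa <;> rcases le_or_gt t a with hta | hta
    · rw [hFa s hsa, hFa t hta] at h
      exact hq.2 hsa hta h
    · obtain ⟨t, rfl⟩ := Nat.exists_eq_add_of_le hta.le
      rw [hFa s hsa, hFb t (by omega)] at h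
      exact absurd h (hqr s hsa t (by omega) (by omega))
    · obtain ⟨s, rfl⟩ := Nat.exists_eq_add_of_le hsa.le
      rw [hFa t hta, hFb s (by omega)] at h
      exact absurd h.symm (hqr t hta s (by omega) (by omega))
    · obtain ⟨t, rfl⟩ := Nat.exists_eq_add_of_le hta.le
      obtain ⟨s, rfl⟩ := Nat.exists_eq_add_of_le hsa.le
      rw [hFb t (by omega), hFb s (by omega)] at h
      rw [hr.2 (by simp; omega : s ∈ Set.Iic b) (by simp; omega : t ∈ Set.Iic b) h]
  refine ⟨fun x => F x.val, ⟨?_, ?_⟩, ?_, ?_⟩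
  · intro x y h
    exact ZMod.val_injective _ (hinj _ (ZMod.val_lt x) _ (ZMod.val_lt y) h)
  · intro x
    have := hadj x.val (ZMod.val_lt x)
    rw [← hval (x.val + 1) (ZMod.val_lt x)] at this
    simpa using this
  · intro s hs
    simp only []
    rw [hval s (by omega), hFa s hs]
  · intro s hs
    simp only []
    rw [hval (a + s) (by omega), hFb s hs]

/-- An arc of a labelled cycle is a path. -/
lemma isPathFun_arc {G : SimpleGraph V} {N L : ℕ} (hL : L < N) {g : ZMod N → V}
    (hg : g ∈ cycleMaps G N) (i : ZMod N) : IsPathFun G L fun s => g (i + s) := by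
  refine ⟨fun s hs => ?_, fun s hs t ht h => ?_⟩
  · have := hg.2 (i + s)
    push_cast
    rwa [← add_assoc]
  · simp only [Set.mem_Iic] at hs ht
    have := (ZMod.natCast_eq_natCast_iff' s t N).1 (add_left_cancel (hg.1 h))
    rwa [Nat.mod_eq_of_lt (by omega), Nat.mod_eq_of_lt (by omega)] at this

/-! ### Bounding the number of `2l`-cycles by the number of `l`-paths. -/

/-- If every nonempty subfamily of `A` has a member which, for some `i`, shares its `i`-th key with
at most `C` members of the subfamily, then `A` has at most `C` elements per key. -/
lemma card_le_mul_card_keys {α I K : Type*} [DecidableEq I] [DecidableEq K]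
    (κ : I → α → K) (C : ℕ) (A : Finset α) (T : Finset (I × K))
    (hT : ∀ f ∈ A, ∀ i, (i, κ i f) ∈ T)
    (h : ∀ B ⊆ A, B.Nonempty → ∃ f ∈ B, ∃ i, (B.filter fun g => κ i g = κ i f).card ≤ C) :
    A.card ≤ C * T.card := by
  classical
  induction A using Finset.strongInduction generalizing T with
  | H A ih =>
    rcases A.eq_empty_or_nonempty with rfl | hne
    · simp
    obtain ⟨f, hf, i, hfi⟩ := h A subset_rfl hne
    have hsub : (A.filter fun g => ¬ κ i g = κ i f) ⊂ A := by
      refine (Finset.filter_ssubset).2 ⟨f, hf, by simp⟩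
    -- Discarding all elements with this key costs at most `C` of them and frees the key for good.
    have h1 := ih _ hsub (T.erase (i, κ i f)) ?_ ?_
    · have h2 := Finset.card_filter_add_card_filter_not (s := A) (fun g => κ i g = κ i f)
      have h3 := Finset.card_erase_add_one (hT f hf i)
      rw [← h3, mul_add, mul_one]
      omega
    · intro g hg j
      rw [Finset.mem_filter] at hg
      refine Finset.mem_erase.2 ⟨fun he => ?_, hT g hg.1 j⟩
      rw [Prod.mk.injEq] at he
      obtain ⟨rfl, he⟩ := he
      exact hg.2 he
    · exact fun B hB => h B (hB.trans hsub.1)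

/-- The vertices on the arc of length `l` starting at `i`. -/
def arc {N : ℕ} (l : ℕ) (i : ZMod N) (g : ZMod N → V) : Fin (l + 1) → V := fun s => g (i + (s : ℕ))

lemma arc_eq_iff {N l : ℕ} {i : ZMod N} {f g : ZMod N → V} :
    arc l i f = arc l i g ↔ ∀ s ≤ l, f (i + (s : ℕ)) = g (i + (s : ℕ)) := by
  constructor
  · intro h s hs
    exact congrFun h ⟨s, by omega⟩
  · intro h
    funext s
    exact h s (by omega)

lemma add_natCast_add_self {l : ℕ} (i : ZMod (2 * l)) : i + (l : ZMod (2 * l)) + l = i := by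
  have : ((2 * l : ℕ) : ZMod (2 * l)) = 0 := ZMod.natCast_self _
  push_cast at this
  rw [add_assoc, ← two_mul, this, add_zero]

/-- In a family of `2 l`-cycles in a graph of girth `2 l` such that more than `C` cycles of the
family contain a given arc, some cycle avoids `S` outside of this arc. -/
lemma GirthGE.exists_avoiding {G : SimpleGraph V} {l C : ℕ} (hG : GirthGE G (2 * l))
    [DecidableEq V] {B : Finset (ZMod (2 * l) → V)} (hB : ∀ g ∈ B, g ∈ cycleMaps G (2 * l))
    {f : ZMod (2 * l) → V} {i : ZMod (2 * l)}
    (hC : C < (B.filter fun g => arc l i g = arc l i f).card) (S : Finset V) (hS : S.card ≤ C) :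
    ∃ g ∈ B, arc l i g = arc l i f ∧ ∀ s : ℕ, 0 < s → s < l → g (i + l + s) ∉ S := by
  by_contra! hcon
  have key : ∀ g ∈ B.filter (fun g => arc l i g = arc l i f),
      ∃ v ∈ S, ∃ s : ℕ, 0 < s ∧ s < l ∧ g (i + l + s) = v := by
    intro g hg
    rw [Finset.mem_filter] at hg
    obtain ⟨s, h1, h2, h3⟩ := hcon g hg.1 hg.2
    exact ⟨_, h3, s, h1, h2, rfl⟩
  have : Nonempty V := ⟨f i⟩
  choose! φ hφS s hs0 hsl hs using key
  have hlt : S.card < (B.filter fun g => arc l i g = arc l i f).card := by omega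
  -- If all these cycles met `S` on the complementary arc, two would meet it in the same vertex.
  -- Complementary arcs have common ends, so sharing an inner vertex makes them equal.
  obtain ⟨g, hg, g', hg', hne, heq⟩ :=
    Finset.exists_ne_map_eq_of_card_lt_of_maps_to hlt (f := φ) hφS
  have e1 := hs g hg
  have e2 := hs g' hg'
  have hl0 := hs0 g hg
  have hl1 := hsl g hg
  have hl0' := hs0 g' hg'
  have hl1' := hsl g' hg'
  rw [Finset.mem_filter] at hg hg'
  have hN : l < 2 * l := by omega
  have harc := arc_eq_iff.1 (hg.2.trans hg'.2.symm)
  have hrest := hG.eq_of_inner_eq (isPathFun_arc hN (hB g hg.1) (i + l))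
    (isPathFun_arc hN (hB g' hg'.1) (i + l)) (by simpa using harc l le_rfl)
    (by simpa [add_natCast_add_self] using harc 0 (by omega)) hl0 hl1 hl0' hl1'
    (e1.trans (heq.trans e2.symm))
  apply hne
  have : NeZero (2 * l) := ⟨by omega⟩
  funext x
  obtain ⟨t, ht, rfl⟩ : ∃ t : ℕ, t < 2 * l ∧ i + t = x :=
    ⟨(x - i).val, ZMod.val_lt _, by rw [ZMod.natCast_zmod_val]; abel⟩
  rcases le_total t l with h | h
  · exact harc t h
  · obtain ⟨r, rfl⟩ := Nat.exists_eq_add_of_le h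
    have h3 := hrest r (by omega)
    push_cast
    rwa [← add_assoc]

/-- In a family of `2 l`-cycles in a graph of girth `2 l` in which every arc of length `l` extends
in many ways, opposite vertices are joined by paths of length `l + 2 j` avoiding small sets. -/
lemma GirthGE.exists_long_path {G : SimpleGraph V} {l C : ℕ} (hl : 2 ≤ l) (hG : GirthGE G (2 * l))
    [DecidableEq V] {B : Finset (ZMod (2 * l) → V)} (hB : ∀ g ∈ B, g ∈ cycleMaps G (2 * l))
    (hC : ∀ f ∈ B, ∀ i, C < (B.filter fun g => arc l i g = arc l i f).card) (j : ℕ) :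
    ∀ f ∈ B, ∀ i : ZMod (2 * l), ∀ S : Finset V, S.card + 2 * j ≤ C → f i ∉ S → f (i + l) ∉ S →
      ∃ q, IsPathFun G (l + 2 * j) q ∧ q 0 = f i ∧ q (l + 2 * j) = f (i + l) ∧
        ∀ s ≤ l + 2 * j, q s ∉ S := by
  induction j with
  | zero =>
    intro f hf i S hS hi hil
    obtain ⟨g, hg, hgf, hgS⟩ := hG.exists_avoiding hB (hC f hf (i + l)) S (by omega)
    rw [arc_eq_iff] at hgf
    have h0 : g i = f i := by simpa [add_natCast_add_self] using hgf l le_rfl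
    have h1 : g (i + l) = f (i + l) := by simpa using hgf 0 (by omega)
    refine ⟨fun s => g (i + s), isPathFun_arc (by omega) (hB g hg) i, by simpa using h0,
      by simpa using h1, fun s hs => ?_⟩
    rcases Nat.eq_zero_or_pos s with rfl | hs0
    · simpa [h0] using hi
    rcases (show s ≤ l by omega).lt_or_eq with hsl | rfl
    · simpa [add_natCast_add_self] using hgS s hs0 hsl
    · simpa [h1] using hil
  | succ j ih =>
    intro f hf i S hS hi hil
    -- Replacing first one half of `f` and then the other yields a cycle `h` through the same two
    -- opposite vertices whose inner vertices all avoid `S`.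
    obtain ⟨g, hg, hgf, hgS⟩ := hG.exists_avoiding hB (hC f hf i) S (by omega)
    obtain ⟨h, hh, hhg, hhS⟩ := hG.exists_avoiding hB (hC g hg (i + l)) S (by omega)
    rw [arc_eq_iff] at hgf hhg
    simp only [add_natCast_add_self] at hhS
    have hh1 : h (i + l) = f (i + l) := by
      have e1 := hhg 0 (by omega)
      have e2 := hgf l le_rfl
      simp only [Nat.cast_zero, add_zero] at e1
      exact e1.trans e2
    have hh0 : h i = f i := by
      have e1 := hhg l le_rfl
      have e2 := hgf 0 (by omega)
      simp only [Nat.cast_zero, add_zero, add_natCast_add_self] at e1 e2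
      exact e1.trans e2
    have hhc := hB h hh
    have hcard : (insert (f i) (insert (f (i + l)) S)).card ≤ S.card + 2 := by
      have := Finset.card_insert_le (f i) (insert (f (i + l)) S)
      have := Finset.card_insert_le (f (i + l)) S
      omega
    have hne : ∀ a b : ℕ, a < 2 * l → b < 2 * l → a ≠ b → h (i + a) ≠ h (i + b) := by
      intro a b ha hb hab he
      apply hab
      have := (ZMod.natCast_eq_natCast_iff' a b (2 * l)).1 (add_left_cancel (hhc.1 he))
      rwa [Nat.mod_eq_of_lt ha, Nat.mod_eq_of_lt hb] at this
    have ecomm : i + 1 + (l : ZMod (2 * l)) = i + (l + 1 : ℕ) := by push_cast; ring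
    -- The opposite pair of `h` shifted by one is joined by a path of length `l + 2 * j`; an edge of
    -- `h` at each end brings it back to the original pair. Forbidding that pair adds two vertices
    -- to `S`, which the drop of `2 * j` by two pays for.
    obtain ⟨q, hq, hq0, hq1, hqS⟩ := ih h hh (i + 1) (insert (f i) (insert (f (i + l)) S))
      (by omega)
      (by
        rw [Finset.mem_insert, Finset.mem_insert, ← hh0, ← hh1]
        push Not
        refine ⟨?_, ?_, ?_⟩
        · simpa using hne 1 0 (by omega) (by omega) (by omega)
        · simpa using hne 1 l (by omega) (by omega) (by omega)
        · simpa using hhS 1 (by omega) (by omega))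
      (by
        rw [Finset.mem_insert, Finset.mem_insert, ← hh0, ← hh1, ecomm]
        push Not
        refine ⟨?_, ?_, ?_⟩
        · simpa using hne (l + 1) 0 (by omega) (by omega) (by omega)
        · exact hne (l + 1) l (by omega) (by omega) (by omega)
        · have e1 := hhg 1 (by omega)
          have e2 := hgS 1 (by omega) (by omega)
          push_cast at e1 e2 ⊢
          rw [← add_assoc, e1]
          exact e2)
    simp only [Finset.mem_insert, not_or] at hqS
    set L := l + 2 * j with hL
    have hL' : l + 2 * (j + 1) = L + 2 := by omega
    have hfi : f i ≠ f (i + l) := by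
      rw [← hh0, ← hh1]
      simpa using hne 0 l (by omega) (by omega) (by omega)
    set r : ℕ → V := fun s => if s = 0 then f i else if s = L + 2 then f (i + l) else q (s - 1)
      with hr
    have r0 : r 0 = f i := by simp [hr]
    have r1 : r (L + 2) = f (i + l) := by simp [hr]
    have rq : ∀ s ≤ L, r (s + 1) = q s := fun s hs => by simp [hr]; omega
    have hcases : ∀ s ≤ L + 2, s = 0 ∨ s = L + 2 ∨ ∃ t ≤ L, s = t + 1 := by
      intro s hs
      rcases Nat.eq_zero_or_pos s with h | h
      · exact Or.inl h
      · rcases hs.lt_or_eq with h' | h'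
        · exact Or.inr (Or.inr ⟨s - 1, by omega, by omega⟩)
        · exact Or.inr (Or.inl h')
    rw [hL']
    refine ⟨r, ⟨fun s hs => ?_, fun s hs t ht hst => ?_⟩, r0, r1, fun s hs => ?_⟩
    · rcases hcases s (by omega) with rfl | rfl | ⟨t, ht, rfl⟩
      · rw [r0, rq 0 (by omega), hq0, ← hh0]
        exact hhc.2 i
      · omega
      · rcases ht.lt_or_eq with h' | rfl
        · rw [rq t ht, rq (t + 1) h']
          exact hq.1 t h'
        · rw [rq _ le_rfl, r1, hq1, ← hh1, add_right_comm]
          exact (hhc.2 _).symm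
    · rcases hcases s hs with rfl | rfl | ⟨a, ha, rfl⟩ <;>
        rcases hcases t ht with rfl | rfl | ⟨b, hb, rfl⟩
      · rfl
      · rw [r0, r1] at hst
        exact absurd hst hfi
      · rw [r0, rq b hb] at hst
        exact absurd hst.symm (hqS b hb).1
      · rw [r0, r1] at hst
        exact absurd hst.symm hfi
      · rfl
      · rw [r1, rq b hb] at hst
        exact absurd hst.symm (hqS b hb).2.1
      · rw [r0, rq a ha] at hst
        exact absurd hst (hqS a ha).1
      · rw [r1, rq a ha] at hst
        exact absurd hst (hqS a ha).2.1
      · rw [rq a ha, rq b hb] at hst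
        rw [hq.2 ha hb hst]
    · rcases hcases s hs with rfl | rfl | ⟨t, ht, rfl⟩
      · rwa [r0]
      · rwa [r1]
      · rw [rq t ht]
        exact (hqS t ht).2.2

/-- A graph of girth `2 l` without `2 k`-cycles has no family of `2 l`-cycles in which every arc of
length `l` extends in more than `2 k` ways. -/
lemma GirthGE.exists_thin_arc {G : SimpleGraph V} {k l : ℕ} (hl : 2 ≤ l) (hkl : l < k)
    (hG : GirthGE G (2 * l)) (hk : cycleMaps G (2 * k) = ∅) [DecidableEq V]
    {B : Finset (ZMod (2 * l) → V)} (hB : ∀ g ∈ B, g ∈ cycleMaps G (2 * l)) (hne : B.Nonempty) :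
    ∃ f ∈ B, ∃ i, (B.filter fun g => arc l i g = arc l i f).card ≤ 2 * k := by
  by_contra! hcon
  obtain ⟨f, hf⟩ := hne
  have hfc := hB f hf
  set S : Finset V := (Finset.Ioo 0 l).image fun s : ℕ => f (l + s) with hS
  have hScard : S.card ≤ l := Finset.card_image_le.trans (by simp)
  have hnot : ∀ a : ℕ, a ≤ l → f a ∉ S := by
    intro a ha h
    rw [hS, Finset.mem_image] at h
    obtain ⟨s, hs, he⟩ := h
    rw [Finset.mem_Ioo] at hs
    have he := hfc.1 he
    rw [← Nat.cast_add] at he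
    have := (ZMod.natCast_eq_natCast_iff' _ _ (2 * l)).1 he
    rw [Nat.mod_eq_of_lt (by omega), Nat.mod_eq_of_lt (by omega)] at this
    omega
  -- The length `l + 2 * (k - l) = 2 * k - l` is what one half of `f` completes to a `2k`-cycle; `S`
  -- is the interior of that half.
  obtain ⟨q, hq, hq0, hq1, hqS⟩ := hG.exists_long_path hl hB hcon (k - l) f hf 0 S (by omega)
    (by simpa using hnot 0 (by omega)) (by simpa using hnot l le_rfl)
  have hr := isPathFun_arc (L := l) (by omega) hfc l
  obtain ⟨g, hg, -, -⟩ := exists_cycleMap_of_paths (by omega) (by omega) hq hr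
    (by simpa using hq1)
    (by
      have := add_natCast_add_self (l := l) 0
      rw [zero_add] at this
      rw [hq0, this])
    (by
      intro s t _ hs ht0 ht he
      apply hqS s hs.le
      rw [he, hS, Finset.mem_image]
      exact ⟨t, by simp; omega, rfl⟩)
  have hk' : cycleMaps G (l + 2 * (k - l) + l) = ∅ := by
    rw [show l + 2 * (k - l) + l = 2 * k by omega, hk]
  rw [hk'] at hg
  exact hg

/-! ### Closed chains in multigraphs and the Frobenius norm. -/

lemma sum_sq_mul_le [Fintype V] (M N : Matrix V V ℕ) : ∑ x : V × V, (M * N) x.1 x.2 ^ 2 ≤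
    (∑ x : V × V, M x.1 x.2 ^ 2) * ∑ x : V × V, N x.1 x.2 ^ 2 := by
  have hN : ∑ x : V × V, N x.1 x.2 ^ 2 = ∑ v, ∑ w, N w v ^ 2 := by
    rw [Fintype.sum_prod_type, Finset.sum_comm]
  rw [hN, Fintype.sum_prod_type, Fintype.sum_prod_type, Finset.sum_mul_sum]
  exact Finset.sum_le_sum fun u _ => Finset.sum_le_sum fun v _ => by
    rw [Matrix.mul_apply]
    exact Finset.sum_mul_sq_le_sq_mul_sq _ _ _

section Multigraph

variable [Fintype V] [DecidableEq V] {α : Type*}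

/-- The number of members of `P` with source `u` and target `v`. -/
def edgeCount (P : Finset α) (s t : α → V) : Matrix V V ℕ :=
  fun u v => (P.filter fun p => s p = u ∧ t p = v).card

lemma sum_edgeCount (P : Finset α) (s t : α → V) :
    ∑ x : V × V, edgeCount P s t x.1 x.2 = P.card := by
  rw [Finset.card_eq_sum_card_fiberwise (f := fun p => (s p, t p)) (t := Finset.univ)
    (fun _ _ => Finset.mem_coe.2 (Finset.mem_univ _))]
  simp [edgeCount, Prod.ext_iff]

lemma sum_edgeCount_sq (P : Finset α) (s t : α → V) :
    ∑ x : V × V, edgeCount P s t x.1 x.2 ^ 2 =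
      ((P ×ˢ P).filter fun p => s p.1 = s p.2 ∧ t p.1 = t p.2).card := by
  rw [Finset.card_eq_sum_card_fiberwise (f := fun p => (s p.1, t p.1)) (t := Finset.univ)
    (fun _ _ => Finset.mem_coe.2 (Finset.mem_univ _))]
  refine Finset.sum_congr rfl fun x _ => ?_
  rw [sq, edgeCount, ← Finset.card_product]
  congr 1
  ext p
  simp only [Finset.mem_product, Finset.mem_filter, Prod.ext_iff]
  grind

/-- Sequences of `j` consecutive edges from `u` to `v`. -/
def IsChain (s t : α → V) (j : ℕ) (u v : V) (q : Fin j → α) : Prop :=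
  ∃ x : Fin (j + 1) → V, x 0 = u ∧ x (Fin.last j) = v ∧
    ∀ i, s (q i) = x i.castSucc ∧ t (q i) = x i.succ

-- Powers of the matrix of edge multiplicities count chains: the first edge is split off, according
-- to its target.
open scoped Classical in
lemma card_chains_le (P : Finset α) (s t : α → V) (j : ℕ) (u v : V) :
    ((Fintype.piFinset fun _ : Fin j => P).filter (IsChain s t j u v)).card ≤
      (edgeCount P s t ^ j) u v := by
  induction j generalizing u with
  | zero =>
    rw [pow_zero, Matrix.one_apply]
    split_ifs with h
    · refine (Finset.card_le_univ _).trans ?_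
      simp
    · rw [Nat.le_zero, Finset.card_eq_zero, Finset.filter_eq_empty_iff]
      rintro q - ⟨x, hx0, hx1, -⟩
      exact h (hx0.symm.trans hx1)
  | succ j ih =>
    rw [pow_succ', Matrix.mul_apply]
    calc _ ≤ (Finset.univ.biUnion fun w => (P.filter fun p => s p = u ∧ t p = w) ×ˢ
          ((Fintype.piFinset fun _ : Fin j => P).filter (IsChain s t j w v))).card := by
          refine Finset.card_le_card_of_injOn (fun q => (q 0, Fin.tail q)) ?_ ?_
          · intro q hq
            rw [Finset.mem_coe, Finset.mem_filter, Fintype.mem_piFinset] at hq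
            obtain ⟨hP, x, hx0, hx1, hx⟩ := hq
            simp only [Finset.coe_biUnion, Set.mem_iUnion, Finset.mem_coe, Finset.mem_product,
              Finset.mem_filter, Fintype.mem_piFinset]
            refine ⟨x 1, Finset.mem_univ _, ⟨hP 0, ?_, (hx 0).2⟩, fun i => hP _, Fin.tail x, rfl,
              hx1, fun i => hx i.succ⟩
            rw [(hx 0).1, ← hx0]
            rfl
          · intro q _ r _ h
            rw [Prod.mk.injEq] at h
            rw [← Fin.cons_self_tail q, ← Fin.cons_self_tail r, h.1, h.2]
      _ ≤ ∑ w, ((P.filter fun p => s p = u ∧ t p = w) ×ˢ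
          ((Fintype.piFinset fun _ : Fin j => P).filter (IsChain s t j w v))).card :=
          Finset.card_biUnion_le
      _ ≤ _ := Finset.sum_le_sum fun w _ => by
          rw [Finset.card_product]
          exact Nat.mul_le_mul le_rfl (ih w)

lemma sum_sq_pow_le (M : Matrix V V ℕ) (j : ℕ) :
    ∑ x : V × V, (M ^ (j + 1)) x.1 x.2 ^ 2 ≤ (∑ x : V × V, M x.1 x.2 ^ 2) ^ (j + 1) := by
  induction j with
  | zero => simp
  | succ j ih =>
    rw [pow_succ M, pow_succ (∑ x : V × V, M x.1 x.2 ^ 2)]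
    exact (sum_sq_mul_le _ _).trans (Nat.mul_le_mul ih le_rfl)

/-- The trace is the inner product of `M ^ (j - 1)` with the transpose of `M`, so Cauchy–Schwarz and
submultiplicativity of the Frobenius norm apply. For `j = 1` the bound fails, e.g. for identity
matrices of size at least two. -/
lemma trace_pow_sq_le (M : Matrix V V ℕ) {j : ℕ} (hj : 2 ≤ j) :
    (M ^ j).trace ^ 2 ≤ (∑ x : V × V, M x.1 x.2 ^ 2) ^ j := by
  obtain ⟨j, rfl⟩ := Nat.exists_eq_add_of_le' hj
  have h1 : (M ^ (j + 2)).trace = ∑ x : V × V, (M ^ (j + 1)) x.1 x.2 * M x.2 x.1 := by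
    rw [pow_succ, Matrix.trace, Fintype.sum_prod_type]
    simp [Matrix.mul_apply]
  have h2 : ∑ x : V × V, M x.1 x.2 ^ 2 = ∑ x : V × V, M x.2 x.1 ^ 2 := by
    rw [Fintype.sum_prod_type, Finset.sum_comm, Fintype.sum_prod_type]
  rw [h1, pow_succ (∑ x : V × V, M x.1 x.2 ^ 2)]
  refine (Finset.sum_mul_sq_le_sq_mul_sq _ _ _).trans ?_
  rw [← h2]
  exact Nat.mul_le_mul (sum_sq_pow_le M j) le_rfl

end Multigraph

/-! ### The upper bound. -/

section Counting

open scoped Classical in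
/-- The paths of length `l` in `G`. -/
noncomputable def pathSet [Fintype V] (G : SimpleGraph V) (l : ℕ) : Finset (Fin (l + 1) → V) :=
  Finset.univ.filter fun p => ∃ q, IsPathFun G l q ∧ p = fun s : Fin (l + 1) => q s

variable [Fintype V]

lemma mem_pathSet {G : SimpleGraph V} {l : ℕ} {p : Fin (l + 1) → V} :
    p ∈ pathSet G l ↔ ∃ q, IsPathFun G l q ∧ p = fun s : Fin (l + 1) => q s := by
  simp [pathSet]

lemma arc_mem_pathSet {G : SimpleGraph V} {N l : ℕ} (hl : l < N) {g : ZMod N → V}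
    (hg : g ∈ cycleMaps G N) (i : ZMod N) : arc l i g ∈ pathSet G l :=
  mem_pathSet.2 ⟨_, isPathFun_arc hl hg i, rfl⟩

variable [DecidableEq V]

/-- The number of paths of length `l` between two vertices. -/
noncomputable def pathCount (G : SimpleGraph V) (l : ℕ) : Matrix V V ℕ :=
  edgeCount (pathSet G l) (fun p => p 0) (fun p => p (Fin.last l))

/-- Peeling through thin arcs; a key is a starting index in `ZMod (2 * l)` together with the path
found there. -/
lemma card_cycleMaps_le {G : SimpleGraph V} {k l : ℕ} (hl : 2 ≤ l) (hkl : l < k)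
    (hG : GirthGE G (2 * l)) (hk : cycleMaps G (2 * k) = ∅) [Fintype (ZMod (2 * l) → V)]
    [DecidablePred (· ∈ cycleMaps G (2 * l))] :
    (Finset.univ.filter (· ∈ cycleMaps G (2 * l))).card ≤
      2 * k * (2 * l * (pathSet G l).card) := by
  have : NeZero (2 * l) := ⟨by omega⟩
  have h := card_le_mul_card_keys (arc l) (2 * k) (Finset.univ.filter (· ∈ cycleMaps G (2 * l)))
    (Finset.univ ×ˢ pathSet G l) (fun f hf i => by
      rw [Finset.mem_filter] at hf
      simpa using arc_mem_pathSet (by omega) hf.2 i)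
    (fun B hB hne => hG.exists_thin_arc hl hkl hk (fun g hg => (Finset.mem_filter.1 (hB hg)).2) hne)
  rwa [Finset.card_product, Finset.card_univ, ZMod.card] at h

-- The left side counts pairs of paths with common ends. Equal pairs give the summand `1`; an
-- unequal pair is internally disjoint and is recovered from the labelled `2l`-cycle that it forms.
open scoped Classical in
lemma sum_pathCount_sq_le {G : SimpleGraph V} {k l : ℕ} (hl : 2 ≤ l) (hkl : l < k)
    (hG : GirthGE G (2 * l)) (hk : cycleMaps G (2 * k) = ∅) :
    ∑ x : V × V, pathCount G l x.1 x.2 ^ 2 ≤ (1 + 2 * k * (2 * l)) * (pathSet G l).card := by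
  have : NeZero (2 * l) := ⟨by omega⟩
  have : NeZero (l + l) := ⟨by omega⟩
  have hcyc := card_cycleMaps_le hl hkl hG hk
  set P := pathSet G l with hP
  rw [pathCount, sum_edgeCount_sq]
  set D := (P ×ˢ P).filter fun p => p.1 0 = p.2 0 ∧ p.1 (Fin.last l) = p.2 (Fin.last l) with hD
  have hdiag : (D.filter fun p => p.1 = p.2).card ≤ P.card := by
    refine Finset.card_le_card_of_injOn Prod.fst (fun p hp => ?_) (fun p hp q hq h => ?_)
    · simp only [hD, Finset.coe_filter, Set.mem_ofPred_eq, Finset.mem_filter,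
        Finset.mem_product] at hp
      exact hp.1.1.1
    · simp only [Finset.coe_filter, Set.mem_ofPred_eq] at hp hq
      exact Prod.ext h (hp.2.symm.trans (h.trans hq.2))
  have hoff : (D.filter fun p => ¬ p.1 = p.2).card ≤
      (Finset.univ.filter (· ∈ cycleMaps G (2 * l))).card := by
    have key : ∀ p ∈ D.filter (fun p => ¬ p.1 = p.2), ∃ g ∈ cycleMaps G (2 * l),
        (∀ s : Fin (l + 1), g ((s : ℕ) : ZMod (2 * l)) = p.1 s) ∧
        -- The second path is traversed backwards on the second half of the cycle.
        ∀ s : Fin (l + 1), g ((l + (l - s : ℕ) : ℕ) : ZMod (2 * l)) = p.2 s := by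
      rintro ⟨p, p'⟩ hp
      simp only [hD, Finset.mem_filter, Finset.mem_product, hP, mem_pathSet] at hp
      obtain ⟨⟨⟨⟨q, hq, rfl⟩, r, hr, rfl⟩, h0, h1⟩, hne⟩ := hp
      simp only [Fin.val_zero, Fin.val_last] at h0 h1
      have := exists_cycleMap_of_paths (by omega : 0 < l) (by omega : 0 < l) hq hr.reverse
        (by simpa using h1) (by simpa using h0.symm) (fun s t hs0 hs ht0 ht he => hne <| by
          have := hG.eq_of_inner_eq hq hr h0 h1 hs0 hs (by omega) (by omega) he
          funext x
          exact this x (by omega))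
      rw [two_mul]
      obtain ⟨g, hg, hg1, hg2⟩ := this
      refine ⟨g, hg, fun s => hg1 s (by omega), fun s => ?_⟩
      rw [hg2 (l - s) (by omega), Nat.sub_sub_self (by omega)]
    rcases (D.filter fun p => ¬ p.1 = p.2).eq_empty_or_nonempty with h | ⟨p, -⟩
    · simp [h]
    have : Nonempty V := ⟨p.1 0⟩
    choose! φ hφ h1 h2 using key
    refine Finset.card_le_card_of_injOn φ (fun p hp => ?_) (fun p hp q hq h => ?_)
    · exact Finset.mem_coe.2 (Finset.mem_filter.2 ⟨Finset.mem_univ _, hφ p hp⟩)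
    · refine Prod.ext (funext fun s => ?_) (funext fun s => ?_)
      · rw [← h1 p hp, ← h1 q hq, h]
      · rw [← h2 p hp, ← h2 q hq, h]
  have := Finset.card_filter_add_card_filter_not (s := D) (fun p => p.1 = p.2)
  rw [add_mul, one_mul, mul_assoc]
  omega

/-- The sum `Y` is at most `K` times the number of paths, whose square is at most `n^2 * Y` by
Cauchy–Schwarz. Hence `Y^2 ≤ K^2 * n^2 * Y`, and `Y` cancels unless it is zero. -/
lemma sum_pathCount_sq_le_card_sq {G : SimpleGraph V} {k l : ℕ} (hl : 2 ≤ l) (hkl : l < k)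
    (hG : GirthGE G (2 * l)) (hk : cycleMaps G (2 * k) = ∅) :
    ∑ x : V × V, pathCount G l x.1 x.2 ^ 2 ≤ ((1 + 2 * k * (2 * l)) * Fintype.card V) ^ 2 := by
  have h1 := sum_pathCount_sq_le hl hkl hG hk
  set Y := ∑ x : V × V, pathCount G l x.1 x.2 ^ 2 with hY
  set K := 1 + 2 * k * (2 * l)
  have h2 : (pathSet G l).card ^ 2 ≤ Fintype.card V ^ 2 * Y := by
    rw [← sum_edgeCount (pathSet G l) (fun p => p 0) (fun p => p (Fin.last l))]
    refine sq_sum_le_card_mul_sum_sq.trans ?_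
    rw [Finset.card_univ, Fintype.card_prod, ← sq, hY, pathCount]
    simp
  rcases Nat.eq_zero_or_pos Y with h | h
  · omega
  · refine Nat.le_of_mul_le_mul_right ?_ h
    calc Y * Y ≤ (K * (pathSet G l).card) * (K * (pathSet G l).card) := Nat.mul_le_mul h1 h1
      _ = K ^ 2 * (pathSet G l).card ^ 2 := by ring
      _ ≤ K ^ 2 * (Fintype.card V ^ 2 * Y) := Nat.mul_le_mul le_rfl h2
      _ = _ := by ring

-- Cutting a labelled cycle at the multiples of `l` gives a closed chain of `m` paths, which
-- determines the cycle.
open scoped Classical in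
lemma card_cycleMaps_le_trace {G : SimpleGraph V} {l m : ℕ} (hl : 2 ≤ l) (hm : 2 ≤ m) :
    Nat.card (cycleMaps G (m * l)) ≤ (pathCount G l ^ m).trace := by
  have hml : l < m * l := by nlinarith
  have : NeZero (m * l) := ⟨by omega⟩
  rw [Nat.card_eq_fintype_card, ← Set.toFinset_card]
  have hcast : ((m * l : ℕ) : ZMod (m * l)) = 0 := ZMod.natCast_self _
  calc (cycleMaps G (m * l)).toFinset.card
      ≤ (Finset.univ.biUnion fun u : V => (Fintype.piFinset fun _ : Fin m => pathSet G l).filter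
          (IsChain (fun p => p 0) (fun p => p (Fin.last l)) m u u)).card := by
        refine Finset.card_le_card_of_injOn
          (fun g (j : Fin m) => arc l ((j * l : ℕ) : ZMod (m * l)) g) ?_ ?_
        · intro g hg
          rw [Finset.mem_coe, Set.mem_toFinset] at hg
          simp only [Finset.coe_biUnion, Set.mem_iUnion, Finset.mem_coe, Finset.mem_filter,
            Fintype.mem_piFinset]
          refine ⟨g 0, Finset.mem_univ _, fun j => arc_mem_pathSet hml hg _,
            fun j => g ((j * l : ℕ) : ZMod (m * l)), by simp, ?_, fun j => ⟨?_, ?_⟩⟩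
          · simp only [Fin.val_last, hcast]
          · simp [arc]
          · simp [arc, add_mul]
        · intro g _ h _ hgh
          funext x
          have hx := ZMod.val_lt x
          have hj : x.val / l < m := (Nat.div_lt_iff_lt_mul (by omega)).2 hx
          have := congrFun (congrFun hgh ⟨x.val / l, hj⟩)
            ⟨x.val % l, (Nat.mod_lt _ (by omega)).trans (Nat.lt_succ_self l)⟩
          simp only [arc] at this
          rw [← Nat.cast_add, Nat.div_add_mod', ZMod.natCast_zmod_val] at this
          exact this
    _ ≤ ∑ u : V, _ := Finset.card_biUnion_le
    _ ≤ ∑ u : V, (pathCount G l ^ m) u u := Finset.sum_le_sum fun u _ => card_chains_le _ _ _ _ _ _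

/-- The number of `m l`-cycles in a graph of girth `2 l` without `2 k`-cycles. -/
lemma card_cycleMaps_le_pow {G : SimpleGraph V} {k l m : ℕ} (hl : 2 ≤ l) (hkl : l < k) (hm : 2 ≤ m)
    (hG : GirthGE G (2 * l)) (hk : cycleMaps G (2 * k) = ∅) :
    Nat.card (cycleMaps G (m * l)) ≤ ((1 + 2 * k * (2 * l)) * Fintype.card V) ^ m := by
  refine (card_cycleMaps_le_trace hl hm).trans ?_
  refine (Nat.pow_le_pow_iff_left two_ne_zero).1 ?_
  refine (trace_pow_sq_le _ hm).trans ?_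
  rw [← pow_mul, mul_comm m 2, pow_mul]
  exact Nat.pow_le_pow_left (sum_pathCount_sq_le_card_sq hl hkl hG hk) m

end Counting

open scoped Classical in
lemma ex_le {k l m : ℕ} (hl : 2 ≤ l) (hkl : l < k) (hm : 2 ≤ m) (n : ℕ) :
    ex n (cycle (m * l)) (cyclesUpTo (2 * l - 1) ∪ {cycle (2 * k)}) ≤
      ((1 + 2 * k * (2 * l)) * n) ^ m := by
  refine Finset.sup_le fun G hG => ?_
  rw [Finset.mem_filter] at hG
  have hml : 2 ≤ m * l := by nlinarith
  refine SimpleGraph.copyCount_le_labelledCopyCount.trans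
    ((labelledCopyCount_le_card_cycleMaps G hml).trans ?_)
  have hgirth : GirthGE G (2 * l) := girthGE_of_free fun i hi hil =>
    hG.2 (cycle i) (Or.inl ⟨i, hi, by omega, rfl⟩)
  have hk : cycleMaps G (2 * k) = ∅ := by
    rw [← Set.not_nonempty_iff_eq_empty, ← cycleGraph_isContained_iff_cycleMaps G (by omega)]
    exact hG.2 (cycle (2 * k)) (Or.inr rfl)
  simpa using card_cycleMaps_le_pow hl hkl hm hgirth hk

/-! ### The ring of theta graphs and its cycle lengths. -/

lemma card_le_copyCount {W ι : Type*} [Fintype V] [Fintype ι] {G : SimpleGraph V}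
    {H : SimpleGraph W} (c : ι → H.Copy G) (hc : Function.Injective fun i => Set.range (c i)) :
    Fintype.card ι ≤ G.copyCount H := by
  classical
  unfold SimpleGraph.copyCount
  rw [← Finset.card_univ]
  refine Finset.card_le_card_of_injOn (fun i => (c i).toSubgraph) (fun i _ => ?_)
    (fun i _ j _ h => ?_)
  · simpa using ⟨(c i).isoToSubgraph⟩
  · apply hc
    have := congrArg SimpleGraph.Subgraph.verts h
    simpa [SimpleGraph.Copy.toSubgraph] using this

lemma cycleMaps_comp_neg {G : SimpleGraph V} {N : ℕ} {g : ZMod N → V} (hg : g ∈ cycleMaps G N) :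
    (fun x => g (-x)) ∈ cycleMaps G N := by
  refine ⟨fun x y h => neg_injective (hg.1 h), fun x => ?_⟩
  have := (hg.2 (-(x + 1))).symm
  rwa [show -(x + 1) + 1 = -x by ring] at this

/-- Vertices at positions divisible by `l` are used only in the first layer. -/
def IsUsed (l m v : ℕ) : Prop := l ∣ v → v / (m * l) = 0

/-- `w` is a successor of `v` in the ring of theta graphs: its position modulo `m l` is the next
one, and both lie in the same layer unless one of them is a branch vertex. -/
def IsSucc (l m v w : ℕ) : Prop :=
  (w : ZMod (m * l)) = v + 1 ∧ IsUsed l m v ∧ IsUsed l m w ∧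
    (l ∣ v ∨ l ∣ w ∨ v / (m * l) = w / (m * l))

lemma eq_of_cast_eq_of_div_eq {N v w : ℕ} (h : (v : ZMod N) = w) (h' : v / N = w / N) : v = w := by
  have := (ZMod.natCast_eq_natCast_iff' v w N).1 h
  rw [← Nat.div_add_mod v N, ← Nat.div_add_mod w N, this, h']

lemma dvd_iff_of_cast_eq {l m v w : ℕ} (h : (v : ZMod (m * l)) = w) : l ∣ v ↔ l ∣ w :=
  ((ZMod.natCast_eq_natCast_iff v w _).1 h).dvd_iff (dvd_mul_left l m)

lemma eq_of_branch {l m v w : ℕ} (hv : IsUsed l m v) (hw : IsUsed l m w) (hl : l ∣ v)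
    (h : (v : ZMod (m * l)) = w) : v = w :=
  eq_of_cast_eq_of_div_eq h ((hv hl).trans (hw ((dvd_iff_of_cast_eq h).1 hl)).symm)

/-- Layers meet only at branch vertices: from an inner vertex, the next vertex either stays in the
layer or is a branch vertex, which its position determines. -/
lemma IsSucc.right_unique {l m v w x : ℕ} (hv : ¬ l ∣ v) (h1 : IsSucc l m v w)
    (h2 : IsSucc l m v x) : w = x := by
  have hwx : (w : ZMod (m * l)) = x := h1.1.trans h2.1.symm
  by_cases hw : l ∣ w
  · exact eq_of_branch h1.2.2.1 h2.2.2.1 hw hwx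
  · have hx : ¬ l ∣ x := fun h => hw ((dvd_iff_of_cast_eq hwx).2 h)
    have e1 := h1.2.2.2
    have e2 := h2.2.2.2
    simp only [hv, hw, hx, false_or] at e1 e2
    exact eq_of_cast_eq_of_div_eq hwx (e1.symm.trans e2)

lemma IsSucc.left_unique {l m v w x : ℕ} (hv : ¬ l ∣ v) (h1 : IsSucc l m w v)
    (h2 : IsSucc l m x v) : w = x := by
  have hwx : (w : ZMod (m * l)) = x := add_right_cancel (h1.1.symm.trans h2.1)
  by_cases hw : l ∣ w
  · exact eq_of_branch h1.2.1 h2.2.1 hw hwx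
  · have hx : ¬ l ∣ x := fun h => hw ((dvd_iff_of_cast_eq hwx).2 h)
    have e1 := h1.2.2.2
    have e2 := h2.2.2.2
    simp only [hv, hw, hx, false_or] at e1 e2
    exact eq_of_cast_eq_of_div_eq hwx (e1.trans e2.symm)

/-- The ring of `m` theta graphs on `n` vertices, with paths of length `l`. -/
def thetaRing (l m n : ℕ) : SimpleGraph (Fin n) where
  Adj v w := v ≠ w ∧ (IsSucc l m v w ∨ IsSucc l m w v)
  symm := ⟨fun _ _ h => ⟨h.1.symm, h.2.symm⟩⟩
  loopless := ⟨fun _ h => h.1 rfl⟩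

variable {l m n N : ℕ} {g : ZMod N → Fin n}

lemma two_ne_zero_of_three_le (hN : 3 ≤ N) : (2 : ZMod N) ≠ 0 := by
  intro h
  have := (ZMod.natCast_eq_zero_iff 2 N).1 (by exact_mod_cast h)
  have := Nat.le_of_dvd (by norm_num) this
  omega

/-- A cycle cannot reverse direction at an inner vertex, which has only one predecessor. -/
lemma isSucc_next (hN : 3 ≤ N) (hg : g ∈ cycleMaps (thetaRing l m n) N) {x : ZMod N}
    (hx : IsSucc l m (g x) (g (x + 1))) (hnb : ¬ l ∣ (g (x + 1) : ℕ)) :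
    IsSucc l m (g (x + 1)) (g (x + 1 + 1)) := by
  refine (hg.2 (x + 1)).2.resolve_right fun h => two_ne_zero_of_three_le hN ?_
  have := hg.1 (Fin.ext (hx.left_unique hnb h))
  rw [add_assoc, left_eq_add, one_add_one_eq_two] at this
  exact this

/-- A cycle which leaves a branch vertex forwards runs to the next branch vertex. -/
lemma isSucc_run (hN : 3 ≤ N) (hg : g ∈ cycleMaps (thetaRing l m n) N) {c : ZMod N}
    (hc : l ∣ (g c : ℕ)) (h : IsSucc l m (g c) (g (c + 1))) (s : ℕ) (hs : s < l) :
    IsSucc l m (g (c + s)) (g (c + s + 1)) ∧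
      ((g (c + s) : ℕ) : ZMod (m * l)) = ((g c + s : ℕ) : ZMod (m * l)) := by
  induction s with
  | zero => simpa using h
  | succ s ih =>
    obtain ⟨h1, h2⟩ := ih (by omega)
    have h3 : ((g (c + s + 1) : ℕ) : ZMod (m * l)) = ((g c + (s + 1) : ℕ) : ZMod (m * l)) := by
      rw [h1.1, h2]
      push_cast
      ring
    have h4 : ¬ l ∣ (g (c + s + 1) : ℕ) := by
      rw [dvd_iff_of_cast_eq h3, Nat.dvd_add_right hc]
      exact fun h => by
        have := Nat.le_of_dvd (by omega) h
        omega
    push_cast at h3 ⊢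
    rw [← add_assoc]
    exact ⟨isSucc_next hN hg h1 h4, h3⟩

lemma isSucc_run_end (hl : 0 < l) (hN : 3 ≤ N) (hg : g ∈ cycleMaps (thetaRing l m n) N) {c : ZMod N}
    (hc : l ∣ (g c : ℕ)) (h : IsSucc l m (g c) (g (c + 1))) :
    IsUsed l m (g (c + l)) ∧
      ((g (c + l) : ℕ) : ZMod (m * l)) = ((g c + l : ℕ) : ZMod (m * l)) := by
  obtain ⟨l, rfl⟩ := Nat.exists_eq_add_of_le' hl
  obtain ⟨h1, h2⟩ := isSucc_run hN hg hc h l (by omega)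
  have e : c + (l : ZMod N) + 1 = c + (l + 1 : ℕ) := by push_cast; ring
  rw [e] at h1
  refine ⟨h1.2.2.1, ?_⟩
  rw [h1.1, h2]
  push_cast
  ring

lemma length_eq_of_forall_isSucc (hl : 2 ≤ l) (hm : 2 ≤ m)
    (hg : g ∈ cycleMaps (thetaRing l m n) N) (h : ∀ x, IsSucc l m (g x) (g (x + 1))) :
    N = m * l := by
  have hpos : 0 < m * l := by positivity
  have : NeZero (m * l) := ⟨by omega⟩
  have hφ : ∀ x (s : ℕ), ((g (x + s) : ℕ) : ZMod (m * l)) = (g x : ℕ) + s := by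
    intro x s
    induction s with
    | zero => simp
    | succ s ih =>
      push_cast
      rw [← add_assoc, (h _).1, ih, add_assoc]
  apply Nat.dvd_antisymm
  -- The cycle reaches the branch vertex at position `0`; after `m * l` more steps it is at position
  -- `0` again, hence at the same vertex.
  · have h0 := hφ 0 (-((g 0 : ℕ) : ZMod (m * l))).val
    rw [ZMod.natCast_zmod_val, add_neg_cancel] at h0
    set y : ZMod N := 0 + ((-((g 0 : ℕ) : ZMod (m * l))).val : ℕ) with hy
    have h1 := hφ y (m * l)
    rw [h0, ZMod.natCast_self, add_zero] at h1
    have hd : l ∣ (g y : ℕ) := (dvd_iff_of_cast_eq (m := m) (w := 0) (by simpa using h0)).2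
      (dvd_zero l)
    have h2 := hg.1 (Fin.ext (eq_of_branch (h _).2.1 (h _).2.1 hd (h0.trans h1.symm)))
    rw [left_eq_add] at h2
    exact (ZMod.natCast_eq_zero_iff _ _).1 h2
  · have := hφ 0 N
    rw [ZMod.natCast_self, zero_add, left_eq_add] at this
    exact (ZMod.natCast_eq_zero_iff _ _).1 this

/-- All cycles in the ring of theta graphs have length `2 l` or `m l`. -/
lemma length_eq_of_mem_cycleMaps (hl : 2 ≤ l) (hm : 2 ≤ m) (hN : 3 ≤ N)
    (hg : g ∈ cycleMaps (thetaRing l m n) N) : N = 2 * l ∨ N = m * l := by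
  have : NeZero N := ⟨by omega⟩
  by_cases hA : ∀ x, IsSucc l m (g x) (g (x + 1))
  · exact Or.inr (length_eq_of_forall_isSucc hl hm hg hA)
  by_cases hB : ∀ x, ¬ IsSucc l m (g x) (g (x + 1))
  · refine Or.inr (length_eq_of_forall_isSucc hl hm (cycleMaps_comp_neg hg) fun x => ?_)
    have := (hg.2 (-(x + 1))).2.resolve_left (hB _)
    rwa [show -(x + 1) + 1 = -x by ring] at this
  push Not at hA hB
  left
  -- A cycle with both directions has a vertex that it leaves forwards on both sides. That vertex is
  -- a branch vertex, and both sides run to the next branch vertex, where they meet after `l` steps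
  -- each.
  obtain ⟨x, hx1, hx2⟩ : ∃ x, ¬ IsSucc l m (g x) (g (x + 1)) ∧
      IsSucc l m (g (x + 1)) (g (x + 1 + 1)) := by
    by_contra! hcon
    obtain ⟨y, hy⟩ := hA
    obtain ⟨z, hz⟩ := hB
    have : ∀ s : ℕ, ¬ IsSucc l m (g (y + s)) (g (y + s + 1)) := by
      intro s
      induction s with
      | zero => simpa using hy
      | succ s ih =>
        push_cast
        rw [← add_assoc]
        exact hcon _ ih
    have h2 := this (z - y).val
    rw [ZMod.natCast_zmod_val, add_sub_cancel] at h2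
    exact h2 hz
  have hx1 := (hg.2 x).2.resolve_left hx1
  set c := x + 1 with hc
  have hxc : x = c - 1 := by rw [hc]; ring
  have hbr : l ∣ (g c : ℕ) := by
    by_contra hnb
    have := hg.1 (Fin.ext (hx1.right_unique hnb hx2))
    rw [hc, add_assoc, left_eq_add, one_add_one_eq_two] at this
    exact two_ne_zero_of_three_le hN this
  have hg' := cycleMaps_comp_neg hg
  obtain ⟨u1, e1⟩ := isSucc_run_end (by omega) hN hg hbr hx2
  obtain ⟨u2, e2⟩ := isSucc_run_end (c := -c) (by omega) hN hg' (by simpa using hbr) (by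
    rw [neg_neg, show -(-c + 1) = x by rw [hxc]; ring]
    exact hx1)
  rw [neg_neg] at e2
  have hd : l ∣ (g (c + l) : ℕ) := (dvd_iff_of_cast_eq e1).2 (dvd_add hbr dvd_rfl)
  have h2l := hg.1 (Fin.ext (eq_of_branch u1 u2 hd (e1.trans e2.symm)))
  have hdvd : N ∣ 2 * l := by
    rw [← ZMod.natCast_eq_zero_iff]
    push_cast
    linear_combination h2l
  by_contra hne
  obtain ⟨r, hr⟩ := hdvd
  -- A proper divisor of `2 * l` is at most `l`, so the cycle would close up within one run,
  -- although the position has advanced by `N < m * l`.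
  have hNl : N ≤ l := by
    rcases r with _ | _ | r
    · omega
    · omega
    · nlinarith
  have hN0 : ((g (c + N) : ℕ) : ZMod (m * l)) = ((g c + N : ℕ) : ZMod (m * l)) := by
    rcases hNl.lt_or_eq with h | h
    · exact (isSucc_run hN hg hbr hx2 N h).2
    · rwa [← h] at e1 ⊢
  rw [ZMod.natCast_self, add_zero, Nat.cast_add, left_eq_add, ZMod.natCast_eq_zero_iff] at hN0
  have := Nat.le_of_dvd (by omega) hN0
  nlinarith

/-! ### Counting the long cycles of the ring. -/

/-- The vertex at position `p` of the cycle of length `m l` given by a choice of layers. -/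
def ringVertex (l m : ℕ) (a : ℕ → ℕ) (p : ℕ) : ℕ :=
  p + m * l * if l ∣ p then 0 else a (p / l)

lemma ringVertex_cast (a : ℕ → ℕ) (p : ℕ) : ((ringVertex l m a p : ℕ) : ZMod (m * l)) = p := by
  rw [ringVertex, Nat.cast_add, Nat.cast_mul, ZMod.natCast_self, zero_mul, add_zero]

lemma ringVertex_div (a : ℕ → ℕ) {p : ℕ} (hp : p < m * l) :
    ringVertex l m a p / (m * l) = if l ∣ p then 0 else a (p / l) := by
  rw [ringVertex, Nat.add_mul_div_left _ _ (by omega), Nat.div_eq_of_lt hp, zero_add]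

lemma isUsed_ringVertex (a : ℕ → ℕ) {p : ℕ} (hp : p < m * l) : IsUsed l m (ringVertex l m a p) := by
  intro h
  rw [ringVertex_div a hp, if_pos ((dvd_iff_of_cast_eq (ringVertex_cast a p)).1 h)]

lemma isSucc_ringVertex [NeZero (m * l)] (hml : 2 ≤ m * l) (a : ℕ → ℕ) (x : ZMod (m * l)) :
    IsSucc l m (ringVertex l m a x.val) (ringVertex l m a (x + 1).val) := by
  have hx := ZMod.val_lt x
  have hx1 := ZMod.val_lt (x + 1)
  refine ⟨by simp [ringVertex_cast], isUsed_ringVertex a hx, isUsed_ringVertex a hx1, ?_⟩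
  rw [dvd_iff_of_cast_eq (ringVertex_cast a _), dvd_iff_of_cast_eq (ringVertex_cast a _),
    ringVertex_div a hx, ringVertex_div a hx1]
  by_cases h1 : l ∣ x.val
  · exact Or.inl h1
  by_cases h2 : l ∣ (x + 1).val
  · exact Or.inr (Or.inl h2)
  refine Or.inr (Or.inr ?_)
  rw [if_neg h1, if_neg h2]
  have : Fact (1 < m * l) := ⟨by omega⟩
  rw [ZMod.val_add, ZMod.val_one] at h2 ⊢
  rcases (show x.val + 1 ≤ m * l by omega).lt_or_eq with h | h
  · rw [Nat.mod_eq_of_lt h] at h2 ⊢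
    rw [Nat.succ_div_of_not_dvd h2]
  · rw [h, Nat.mod_self] at h2
    exact absurd (dvd_zero l) h2

lemma ringVertex_lt {t : ℕ} {a : ℕ → ℕ} (ha : ∀ j, a j < t) {p : ℕ} (hp : p < m * l) :
    ringVertex l m a p < m * l * t := by
  have : (if l ∣ p then 0 else a (p / l)) + 1 ≤ t := by
    split_ifs
    · exact (Nat.zero_le _).trans_lt (ha 0)
    · exact ha _
  rw [ringVertex]
  calc _ < m * l + m * l * (if l ∣ p then 0 else a (p / l)) := by omega
    _ = m * l * ((if l ∣ p then 0 else a (p / l)) + 1) := by ring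
    _ ≤ _ := Nat.mul_le_mul le_rfl this

lemma pow_le_copyCount_thetaRing (hl : 2 ≤ l) (hm : 2 ≤ m) {t : ℕ} (hn : m * l * t ≤ n) :
    t ^ m ≤ (thetaRing l m n).copyCount (SimpleGraph.cycleGraph (m * l)) := by
  have hml : 2 ≤ m * l := by nlinarith
  have : NeZero (m * l) := ⟨by omega⟩
  have : NeZero m := ⟨by omega⟩
  have hlayer : ∀ a : Fin m → Fin t, ∀ j : ℕ, (a (Fin.ofNat m j) : ℕ) < t := fun a j => (a _).2
  have key : ∀ a : Fin m → Fin t, ∃ c : (SimpleGraph.cycleGraph (m * l)).Copy (thetaRing l m n),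
      ∀ v, v ∈ Set.range c ↔
        ∃ p < m * l, (v : ℕ) = ringVertex l m (fun j => a (Fin.ofNat m j)) p := by
    intro a
    have hlt : ∀ x : ZMod (m * l), ringVertex l m (fun j => a (Fin.ofNat m j)) x.val < n :=
      fun x => (ringVertex_lt (hlayer a) (ZMod.val_lt x)).trans_le hn
    have hinj : Function.Injective fun x : ZMod (m * l) => (⟨_, hlt x⟩ : Fin n) := by
      intro x y h
      have := congrArg (fun v : ℕ => (v : ZMod (m * l))) (Fin.mk.inj h)
      simpa [ringVertex_cast] using this
    have hmem : (fun x : ZMod (m * l) => (⟨_, hlt x⟩ : Fin n)) ∈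
        cycleMaps (thetaRing l m n) (m * l) := by
      refine ⟨hinj, fun x => ⟨fun h => ?_,
        Or.inl (isSucc_ringVertex hml (fun j => (a (Fin.ofNat m j) : ℕ)) x)⟩⟩
      have h1 := hinj h
      rw [left_eq_add] at h1
      have : Fact (1 < m * l) := ⟨by omega⟩
      exact one_ne_zero h1
    obtain ⟨c, hc⟩ := exists_copy_of_mem_cycleMaps hml hmem
    refine ⟨c, fun v => ?_⟩
    rw [hc]
    constructor
    · rintro ⟨x, rfl⟩
      exact ⟨x.val, ZMod.val_lt x, rfl⟩
    · rintro ⟨p, hp, hv⟩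
      refine ⟨p, Fin.ext ?_⟩
      rw [hv]
      simp only [ZMod.val_natCast, Nat.mod_eq_of_lt hp]
  choose c hc using key
  have hcard : Fintype.card (Fin m → Fin t) = t ^ m := by simp
  rw [← hcard]
  -- The layer chosen in gap `j` is read off from the vertex set at position `j * l + 1`, which is
  -- an inner position because `l ≥ 2`.
  refine card_le_copyCount c fun a b hab => funext fun j => ?_
  have hj : (j : ℕ) * l + 1 < m * l := by
    have := Nat.mul_le_mul_right l (show (j : ℕ) + 1 ≤ m from j.2)
    rw [add_mul] at this
    omega
  have hnd : ¬ l ∣ (j : ℕ) * l + 1 := by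
    rw [Nat.dvd_add_right (dvd_mul_left _ _), Nat.dvd_one]
    omega
  have hdiv : ((j : ℕ) * l + 1) / l = j := by
    rw [add_comm, Nat.add_mul_div_right _ _ (by omega), Nat.div_eq_of_lt (by omega), zero_add]
  have hmem : (⟨ringVertex l m (fun j => a (Fin.ofNat m j)) (j * l + 1),
      (ringVertex_lt (hlayer a) hj).trans_le hn⟩ : Fin n) ∈ Set.range (c b) := by
    rw [← show Set.range (c a) = Set.range (c b) from hab, hc]
    exact ⟨_, hj, rfl⟩
  rw [hc] at hmem
  obtain ⟨p, hp, hv⟩ := hmem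
  simp only at hv
  have h1 := congrArg (fun v : ℕ => (v : ZMod (m * l))) hv
  simp only [ringVertex_cast] at h1
  rw [ZMod.natCast_eq_natCast_iff', Nat.mod_eq_of_lt hj, Nat.mod_eq_of_lt hp] at h1
  subst h1
  have h2 := congrArg (· / (m * l)) hv
  simp only [ringVertex_div _ hj, if_neg hnd, hdiv] at h2
  simpa [Fin.ext_iff] using h2

open scoped Classical in
lemma pow_le_ex {k : ℕ} (hl : 2 ≤ l) (hkl : l < k) (hm : 2 ≤ m) (hne : 2 * k ≠ m * l) (n : ℕ) :
    (n / (m * l)) ^ m ≤ ex n (cycle (m * l)) (cyclesUpTo (2 * l - 1) ∪ {cycle (2 * k)}) := by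
  refine (pow_le_copyCount_thetaRing hl hm (n := n) (Nat.mul_div_le n (m * l))).trans ?_
  have hml : 2 * l ≤ m * l := Nat.mul_le_mul_right l hm
  refine Finset.le_sup (f := fun G : SimpleGraph (Fin n) => G.copyCount (cycle (m * l)).2)
    (Finset.mem_filter.2 ⟨Finset.mem_univ _, ?_⟩)
  have hfree : ∀ N, 3 ≤ N → N ≠ 2 * l → N ≠ m * l →
      (SimpleGraph.cycleGraph N).Free (thetaRing l m n) := by
    intro N hN h1 h2 hcon
    obtain ⟨g, hg⟩ := (cycleGraph_isContained_iff_cycleMaps _ (by omega)).1 hcon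
    exact (length_eq_of_mem_cycleMaps hl hm hN hg).elim h1 h2
  rintro F (⟨i, hi, hil, rfl⟩ | rfl)
  · exact hfree i hi (by omega) (by omega)
  · exact hfree (2 * k) (by omega) (by omega) hne

end GenTuran

/-! ### The asymptotic statement. -/

theorem theorem2p5 (k l m : ℕ) (hl : 2 ≤ l) (hkl : l < k) (hm : 2 ≤ m) (hne : 2 * k ≠ m * l) :
    (fun n : ℕ => (GenTuran.ex n (GenTuran.cycle (m * l))
        (GenTuran.cyclesUpTo (2 * l - 1) ∪ {GenTuran.cycle (2 * k)}) : ℝ))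
      =Θ[atTop] (fun n : ℕ => (n : ℝ) ^ m) := by
  constructor
  · refine IsBigO.of_bound (((1 + 2 * k * (2 * l) : ℕ) : ℝ) ^ m) (Eventually.of_forall fun n => ?_)
    rw [Real.norm_of_nonneg (by positivity), Real.norm_of_nonneg (by positivity), ← mul_pow]
    exact_mod_cast GenTuran.ex_le hl hkl hm n
  · refine IsBigO.of_bound (((2 * (m * l) : ℕ) : ℝ) ^ m) ?_
    filter_upwards [eventually_ge_atTop (m * l)] with n hn
    rw [Real.norm_of_nonneg (by positivity), Real.norm_of_nonneg (by positivity)]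
    have hpos : 0 < m * l := by positivity
    -- Rounding down loses at most a factor of two once `n ≥ m * l`.
    have h1 : n ≤ 2 * (m * l) * (n / (m * l)) := by
      have h2 := Nat.lt_mul_div_succ n hpos
      have h3 : 1 ≤ n / (m * l) := (Nat.one_le_div_iff hpos).2 hn
      nlinarith
    have h2 : n ^ m ≤ (2 * (m * l)) ^ m * GenTuran.ex n (GenTuran.cycle (m * l))
        (GenTuran.cyclesUpTo (2 * l - 1) ∪ {GenTuran.cycle (2 * k)}) := by
      refine (Nat.pow_le_pow_left h1 m).trans ?_
      rw [mul_pow]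
      exact Nat.mul_le_mul le_rfl (GenTuran.pow_le_ex hl hkl hm hne n)
    exact_mod_cast h2
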